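/- Let $S(n,j)$ denote the Stirling numbers of the second kind, let $B_n(x)=\sum_{j=0}^n S(n,j)x^j$ for $n\ge 0$ be the Bell polynomials, and put $B_i=0$ for $i<0$. Let $K\ge 0$ be an integer, let $\gamma_0,\dots,\gamma_K$ be real numbers with $\gamma_0=1$, and define $$p_n(x)=\sum_{j=0}^K\gamma_jB_{n-j}(x)\quad(n\ge 0),\qquad P(x)=\sum_{j=0}^K\gamma_jx^{K-j}.$$ Assume that $P(m)\neq 0$ for every positive integer $m$. Let $\mathcal H$ be the set of positive integers $l$ with $P(l)P(l+1)<0$, and let $\mathcal G=\{1,2,3,\dots\}\setminus\mathcal H$. Then $\mathcal H$ is finite and $\mathcal G$ is infinite. Write $s_{\mathcal H}$ for the number of elements of $\mathcal H$, $h_1<h_2<\dots<h_{s_{\mathcal H}}$ for the elements of $\mathcal H$, and $g_1<g_2<\cdots$ for those of $\mathcal G$. The following hold. (1) There exists $n_0$ such that for every $n\ge n_0$ the polynomial $p_n$ has exactly $s_{\mathcal H}$ positive zeros, and they are all simple. (2) Let $\xi_1^+(n)\le\xi_2^+(n)\le\cdots$ be the positive zeros of $p_n$ in increasing order, repeated according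 to multiplicity. Then for every $m$ with $1\le m\le s_{\mathcal H}$, $$\lim_{n\to\infty}\frac{\xi_m^+(n)}{-\frac{h_mP(h_m)}{P(h_m+1)}\left(\frac{h_m}{h_m+1}\right)^{n-K-1}}=1.$$ (3) Let $\xi_1^-(n)\ge\xi_2^-(n)\ge\cdots$ be the negative zeros of $p_n$ in decreasing order, repeated according to multiplicity. For every positive integer $m$ there exists $n_0$ such that for every $n\ge n_0$ the polynomial $p_n$ has at least $m$ negative zeros counted with multiplicity, and $\xi_1^-(n),\dots,\xi_m^-(n)$ are simple zeros of $p_n$. Moreover, for every positive integer $m$, $$\lim_{n\to\infty}\frac{\xi_m^-(n)}{-\frac{g_mP(g_m)}{P(g_m+1)}\left(\frac{g_m}{g_m+1}\right)^{n-K-1}}=1.$$ -/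

import Mathlib

open Polynomial Filter Topology

namespace BellZeros

noncomputable section

/-- The `n`-th Bell polynomial `∑_{j=0}^n S(n,j) x^j`, with `S(n,j)` the Stirling numbers of the
second kind. -/
def bell (n : ℕ) : ℝ[X] :=
  ∑ j ∈ Finset.range (n + 1), C (Nat.stirlingSecond n j : ℝ) * X ^ j

/-- `p_n = ∑_{j=0}^K γ_j B_{n-j}`, where `B_i = 0` for `i < 0`. -/
def bellComb (K : ℕ) (γ : ℕ → ℝ) (n : ℕ) : ℝ[X] :=
  ∑ j ∈ Finset.range (K + 1), if j ≤ n then C (γ j) * bell (n - j) else 0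

/-- `P(x) = ∑_{j=0}^K γ_j x^{K-j}`. -/
def charPoly (K : ℕ) (γ : ℕ → ℝ) : ℝ[X] :=
  ∑ j ∈ Finset.range (K + 1), C (γ j) * X ^ (K - j)

/-- The positive integers `l` with `P(l) P(l+1) < 0`. -/
def signChangeSet (P : ℝ[X]) : Set ℕ :=
  {l | 0 < l ∧ P.eval (l : ℝ) * P.eval ((l : ℝ) + 1) < 0}

/-- The positive integers that do not belong to `signChangeSet P`. -/
def signKeepSet (P : ℝ[X]) : Set ℕ :=
  {l | 0 < l ∧ l ∉ signChangeSet P}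

/-- The positive zeros of `p`, repeated according to multiplicity, in increasing order. -/
def posZeros (p : ℝ[X]) : List ℝ :=
  (p.roots.filter (fun x => 0 < x)).sort (· ≤ ·)

/-- The negative zeros of `p`, repeated according to multiplicity, in decreasing order. -/
def negZeros (p : ℝ[X]) : List ℝ :=
  (p.roots.filter (fun x => x < 0)).sort (· ≥ ·)

/-- The quantity `-(l P(l) / P(l+1)) (l/(l+1))^{n-K-1}`, with exponent in `ℤ`. -/
def zeroApprox (K : ℕ) (P : ℝ[X]) (l n : ℕ) : ℝ :=
  -((l : ℝ) * P.eval (l : ℝ) / P.eval ((l : ℝ) + 1)) *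
    ((l : ℝ) / ((l : ℝ) + 1)) ^ ((n : ℤ) - (K : ℤ) - 1)

end

end BellZeros

/-! Let `bellMap` send `x^n` to `B_n`, so that `p_{N+K}` is the image of `x^N P`. Dobinski's formula
gives `e^x p_{N+K}(x) = ∑ k^N P(k) x^k / k!`.

Existence: put `x = z q^N` with `q = l/(l+1)`. The sequence `k q^k` is maximal exactly at `k = l`
and `k = l + 1`, so after division by `(l q^l)^N` only these two terms survive as `N → ∞`
(`tendsto_tsum_scaled`). They cancel at `z = balancePoint P l`, with a sign change there, so a real
zero lies near `balancePoint P l * q^N` (`eventually_exists_zero_near`). It is positive for `l ∈ H`,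
negative for `l ∈ G`, and distinct `l` live on distinct scales.

Upper bound: multiplying the symbol by `x - α` turns `p` into `x p' + x p - α p`, which up to a
nonvanishing factor is the derivative of `e^x |x|^(-α) p`. By Rolle an interval avoiding `0` loses
at most one zero (`zeroCount_le_succ`). Taking `α = l + 1/2` removes the sign change of `P(k) σ^k`
between `l` and `l + 1`. Once the relevant changes are gone, the series has no zero of sign `σ` at
all (`no_zero_of_forall_pos`) or none near the origin (`eventually_no_zero`). The bound equals the
number of zeros already found, so these are all the zeros concerned, and they are simple. -/

namespace BellZeros

/-! ### Dobinski's formula and the symbol map -/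

/-- A power is a combination of descending factorials with Stirling numbers as coefficients. -/
theorem pow_eq_sum_stirlingSecond_mul_descFactorial (n k : ℕ) :
    k ^ n = ∑ j ∈ Finset.range (n + 1), Nat.stirlingSecond n j * k.descFactorial j := by
  induction n with
  | zero => simp
  | succ n ih =>
    have hstep : ∀ j, k * k.descFactorial j = j * k.descFactorial j + k.descFactorial (j + 1) := by
      intro j
      rw [Nat.descFactorial_succ]
      rcases le_or_gt j k with h | h
      · rw [← add_mul, Nat.add_sub_cancel' h]
      · simp [Nat.descFactorial_of_lt h]
    rw [Finset.sum_range_succ', pow_succ, ih, Finset.sum_mul]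
    simp only [Nat.stirlingSecond_succ_succ, Nat.stirlingSecond_succ_zero, zero_mul, add_zero,
      add_mul, Finset.sum_add_distrib]
    have h1 : ∑ j ∈ Finset.range (n + 1),
        (j + 1) * Nat.stirlingSecond n (j + 1) * k.descFactorial (j + 1) =
        ∑ j ∈ Finset.range (n + 1), j * Nat.stirlingSecond n j * k.descFactorial j := by
      have h2 := Finset.sum_range_succ'
        (fun j => j * Nat.stirlingSecond n j * k.descFactorial j) (n + 1)
      rw [Finset.sum_range_succ, Nat.stirlingSecond_eq_zero_of_lt (Nat.lt_succ_self n)] at h2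
      simpa using h2.symm
    have h3 : ∀ j, Nat.stirlingSecond n j * k.descFactorial j * k =
        j * Nat.stirlingSecond n j * k.descFactorial j +
          Nat.stirlingSecond n j * k.descFactorial (j + 1) := by
      intro j
      rw [mul_assoc, mul_comm _ k, hstep]
      ring
    simp only [h3, Finset.sum_add_distrib, ← h1, add_mul]

/-- The terms with `k < j` vanish; in the others the descending factorial cancels against `k!` and
leaves the exponential series times `x^j`. -/
theorem hasSum_descFactorial_mul_pow_div_factorial (j : ℕ) (x : ℝ) :
    HasSum (fun k : ℕ => (k.descFactorial j : ℝ) * x ^ k / k.factorial) (Real.exp x * x ^ j) := by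
  have hzero : ∑ k ∈ Finset.range j, (k.descFactorial j : ℝ) * x ^ k / k.factorial = 0 := by
    refine Finset.sum_eq_zero fun k hk => ?_
    rw [Nat.descFactorial_of_lt (Finset.mem_range.1 hk)]
    simp
  rw [← hasSum_nat_add_iff' j, hzero, sub_zero]
  have h := (NormedSpace.expSeries_div_hasSum_exp (𝔸 := ℝ) x).mul_right (x ^ j)
  rw [← Real.exp_eq_exp_ℝ] at h
  refine h.congr_fun fun k => ?_
  have h1 : ((k.factorial * (k + j).descFactorial j : ℕ) : ℝ) = ((k + j).factorial : ℕ) := by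
    have := Nat.factorial_mul_descFactorial (Nat.le_add_left j k)
    rw [Nat.add_sub_cancel] at this
    rw [this]
  push_cast at h1
  have h2 : (k.factorial : ℝ) ≠ 0 := by positivity
  have h3 : ((k + j).factorial : ℝ) ≠ 0 := by positivity
  rw [div_mul_eq_mul_div, div_eq_div_iff h3 h2, ← h1]
  ring

/-- Dobinski's formula. -/
theorem hasSum_pow_mul_pow_div_factorial (n : ℕ) (x : ℝ) :
    HasSum (fun k : ℕ => (k : ℝ) ^ n * x ^ k / k.factorial)
      (Real.exp x * (bell n).eval x) := by
  have h := hasSum_sum (s := Finset.range (n + 1)) (fun j _ =>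
    (hasSum_descFactorial_mul_pow_div_factorial j x).mul_left (Nat.stirlingSecond n j : ℝ))
  have h1 : Real.exp x * (bell n).eval x = ∑ j ∈ Finset.range (n + 1),
      (Nat.stirlingSecond n j : ℝ) * (Real.exp x * x ^ j) := by
    simp only [bell, eval_finsetSum, eval_mul, eval_C, eval_pow, eval_X, Finset.mul_sum]
    exact Finset.sum_congr rfl fun _ _ => by ring
  rw [h1]
  refine h.congr_fun fun k => ?_
  have h2 : ((k : ℝ)) ^ n = ((k ^ n : ℕ) : ℝ) := by push_cast; rfl
  simp only [h2, pow_eq_sum_stirlingSecond_mul_descFactorial]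
  push_cast
  rw [Finset.sum_mul, Finset.sum_div]
  exact Finset.sum_congr rfl fun _ _ => by ring

theorem coeff_bell (n k : ℕ) : (bell n).coeff k = Nat.stirlingSecond n k := by
  simp only [bell, finsetSum_coeff, coeff_C_mul, coeff_X_pow]
  simp only [mul_ite, mul_one, mul_zero, Finset.sum_ite_eq, Finset.mem_range]
  split_ifs with h
  · rfl
  · rw [Nat.stirlingSecond_eq_zero_of_lt (by omega)]; simp

theorem bell_succ (n : ℕ) : bell (n + 1) = X * derivative (bell n) + X * bell n := by
  ext k
  cases k with
  | zero => simp [coeff_bell]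
  | succ k =>
    simp only [coeff_add, coeff_X_mul, coeff_derivative, coeff_bell, Nat.stirlingSecond_succ_succ]
    push_cast
    ring

/-- The linear map that sends `x^n` to the `n`-th Bell polynomial. -/
noncomputable def bellMap : ℝ[X] →ₗ[ℝ] ℝ[X] := (basisMonomials ℝ).constr ℝ bell

theorem bellMap_monomial (n : ℕ) (a : ℝ) : bellMap (monomial n a) = C a * bell n := by
  have h : monomial n a = a • basisMonomials ℝ n := by simp [smul_monomial]
  rw [h, map_smul, bellMap, Module.Basis.constr_basis, smul_eq_C_mul]

/-- The Stirling recurrence in operator form: multiplication by `x` on symbols becomes `x d/dx + x`.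
This links factors of the symbol to Rolle's theorem. -/
theorem bellMap_X_mul (Q : ℝ[X]) :
    bellMap (X * Q) = X * derivative (bellMap Q) + X * bellMap Q := by
  induction Q using Polynomial.induction_on' with
  | add p q hp hq => rw [mul_add, map_add, map_add, hp, hq, derivative_add]; ring
  | monomial n a =>
    rw [X_mul_monomial, bellMap_monomial, bellMap_monomial, bell_succ, derivative_C_mul]
    ring

/-- Dobinski's formula for combinations of Bell polynomials. -/
theorem hasSum_eval_mul_pow_div_factorial (Q : ℝ[X]) (x : ℝ) :
    HasSum (fun k : ℕ => Q.eval (k : ℝ) * x ^ k / k.factorial)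
      (Real.exp x * (bellMap Q).eval x) := by
  induction Q using Polynomial.induction_on' with
  | add p q hp hq =>
    rw [map_add, eval_add, mul_add]
    refine (hp.add hq).congr_fun fun k => ?_
    rw [eval_add]; ring
  | monomial n a =>
    rw [bellMap_monomial, eval_mul, eval_C, mul_left_comm]
    refine ((hasSum_pow_mul_pow_div_factorial n x).mul_left a).congr_fun fun k => ?_
    rw [eval_monomial]; ring

/-- With index `N + K` the convention `B_i = 0` for `i < 0` never comes into play. -/
theorem bellComb_eq_bellMap (K : ℕ) (γ : ℕ → ℝ) (N : ℕ) :
    bellComb K γ (N + K) = bellMap (X ^ N * charPoly K γ) := by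
  rw [charPoly, Finset.mul_sum, map_sum, bellComb]
  refine Finset.sum_congr rfl fun j hj => ?_
  have hj' : j ≤ K := Nat.lt_succ_iff.1 (Finset.mem_range.1 hj)
  rw [if_pos (by omega), mul_left_comm, ← pow_add, C_mul_X_pow_eq_monomial, bellMap_monomial,
    Nat.add_sub_assoc hj']

/-! ### Rolle bounds for the number of zeros -/

/-- The number of zeros of `p` in `D`, counted with multiplicity. -/
noncomputable def zeroCount (p : ℝ[X]) (D : Set ℝ) : ℕ := by
  classical exact Multiset.card (p.roots.filter (· ∈ D))

/-- `Real.log x` is `log |x|`, so one formula serves both half-lines. -/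
theorem hasDerivAt_exp_mul_eval (p : ℝ[X]) (α : ℝ) {x : ℝ} (hx : x ≠ 0) :
    HasDerivAt (fun y => Real.exp (y - α * Real.log y) * p.eval y)
      (Real.exp (x - α * Real.log x) / x *
        (X * derivative p + X * p - C α * p).eval x) x := by
  have h := ((hasDerivAt_id x).sub ((Real.hasDerivAt_log hx).const_mul α)).exp.mul (p.hasDerivAt x)
  refine h.congr_deriv ?_
  simp only [eval_add, eval_sub, eval_mul, eval_X, eval_C, Pi.sub_apply, id]
  field_simp
  ring

theorem rootMultiplicity_sub_one_le (p : ℝ[X]) (α x : ℝ)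
    (hq : X * derivative p + X * p - C α * p ≠ 0) :
    p.rootMultiplicity x - 1 ≤ (X * derivative p + X * p - C α * p).rootMultiplicity x := by
  rw [le_rootMultiplicity_iff hq]
  have h1 : (X - C x) ^ (p.rootMultiplicity x - 1) ∣ p :=
    (pow_dvd_pow _ (Nat.sub_le _ _)).trans (pow_rootMultiplicity_dvd p x)
  have h2 : (X - C x) ^ (p.rootMultiplicity x - 1) ∣ derivative p := by
    by_cases h : derivative p = 0
    · simp [h]
    · exact (le_rootMultiplicity_iff h).1
        (rootMultiplicity_sub_one_le_derivative_rootMultiplicity _ _)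
  exact dvd_sub (dvd_add (h2.mul_left _) (h1.mul_left _)) (h1.mul_left _)

/-- Rolle's theorem with multiplicities, for `exp x * |x| ^ (-α) * p`. -/
theorem zeroCount_le_succ (p : ℝ[X]) (α : ℝ) {D : Set ℝ} (hD : D.OrdConnected) (h0 : 0 ∉ D)
    (hq : X * derivative p + X * p - C α * p ≠ 0) :
    zeroCount p D ≤ zeroCount (X * derivative p + X * p - C α * p) D + 1 := by
  classical
  set q := X * derivative p + X * p - C α * p with hqdef
  have hp : p ≠ 0 := by rintro rfl; simp [hqdef] at hq
  set A := p.roots.filter (· ∈ D) with hA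
  set B := q.roots.filter (· ∈ D) with hB
  have hcA : ∀ x ∈ A.toFinset, A.count x = p.rootMultiplicity x := by
    intro x hx
    rw [Multiset.mem_toFinset, hA, Multiset.mem_filter] at hx
    rw [hA, Multiset.count_filter_of_pos hx.2, count_roots]
  have hcB : ∀ x ∈ A.toFinset, B.count x = q.rootMultiplicity x := by
    intro x hx
    rw [Multiset.mem_toFinset, hA, Multiset.mem_filter] at hx
    rw [hB, Multiset.count_filter_of_pos hx.2, count_roots]
  -- Rolle supplies a zero of `q` strictly between consecutive distinct zeros of `p`; these are new
  -- zeros, counted apart from the inherited multiplicities.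
  have hinter : A.toFinset.card ≤ (B.toFinset \ A.toFinset).card + 1 := by
    refine Finset.card_le_sdiff_of_interleaved fun x hx y hy hxy _ => ?_
    rw [Multiset.mem_toFinset, hA, Multiset.mem_filter, mem_roots hp] at hx hy
    have hne : ∀ z ∈ Set.Icc x y, z ∈ D ∧ z ≠ 0 := fun z hz =>
      ⟨hD.out hx.2 hy.2 hz, fun h => h0 (h ▸ hD.out hx.2 hy.2 hz)⟩
    obtain ⟨z, hz, hz'⟩ := exists_hasDerivAt_eq_zero
      (f := fun y => Real.exp (y - α * Real.log y) * p.eval y) hxy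
      (fun z hz => (hasDerivAt_exp_mul_eval p α (hne z hz).2).continuousAt.continuousWithinAt)
      (by simp only [hx.1.eq_zero, hy.1.eq_zero, mul_zero])
      (fun z hz => hasDerivAt_exp_mul_eval p α (hne z (Set.Ioo_subset_Icc_self hz)).2)
    refine ⟨z, ?_, hz⟩
    have hz1 := hne z (Set.Ioo_subset_Icc_self hz)
    rw [Multiset.mem_toFinset, hB, Multiset.mem_filter, mem_roots hq]
    refine ⟨?_, hz1.1⟩
    rcases mul_eq_zero.1 hz' with h | h
    · exact absurd h (div_ne_zero (Real.exp_ne_zero _) hz1.2)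
    · exact h
  calc zeroCount p D = ∑ x ∈ A.toFinset, A.count x := (Multiset.toFinset_sum_count_eq _).symm
    _ = ∑ x ∈ A.toFinset, (A.count x - 1 + 1) :=
      (Finset.sum_congr rfl fun _ hx => tsub_add_cancel_of_le <|
        Nat.succ_le_iff.2 <| Multiset.count_pos.2 <| Multiset.mem_toFinset.1 hx).symm
    _ = (∑ x ∈ A.toFinset, (A.count x - 1)) + A.toFinset.card := by
      simp only [Finset.sum_add_distrib, Finset.card_eq_sum_ones]
    _ ≤ (∑ x ∈ A.toFinset, B.count x) + ((B.toFinset \ A.toFinset).card + 1) := by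
      refine add_le_add (Finset.sum_le_sum fun x hx => ?_) hinter
      rw [hcA x hx, hcB x hx]
      exact rootMultiplicity_sub_one_le p α x hq
    _ ≤ (∑ x ∈ A.toFinset, B.count x) + ((∑ x ∈ B.toFinset \ A.toFinset, B.count x) + 1) := by
      rw [Finset.card_eq_sum_ones]
      gcongr with x hx
      rw [Nat.succ_le_iff, Multiset.count_pos, ← Multiset.mem_toFinset]
      exact (Finset.mem_sdiff.1 hx).1
    _ = zeroCount q D + 1 := by
      rw [← add_assoc, ← Finset.sum_union Finset.disjoint_sdiff, Finset.union_sdiff_self_eq_union,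
        zeroCount, ← hB, ← Multiset.toFinset_sum_count_eq,
        ← Finset.sum_subset Finset.subset_union_right]
      intro x _ hx₂
      simpa only [Multiset.mem_toFinset, Multiset.count_eq_zero] using hx₂

/-- Zeros of a Bell combination in `D` are at most as many as the linear factors `X - α` by which
one has to multiply its symbol to remove all zeros from `D`. -/
theorem zeroCount_bellMap_le (T : Finset ℕ) (α : ℕ → ℝ) (R : ℝ[X]) {D : Set ℝ}
    (hD : D.OrdConnected) (h0 : 0 ∉ D) (hne : D.Nonempty)
    (h : ∀ x ∈ D, (bellMap ((∏ l ∈ T, (X - C (α l))) * R)).eval x ≠ 0) :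
    zeroCount (bellMap R) D ≤ T.card := by
  classical
  induction T using Finset.induction_on generalizing R with
  | empty =>
    simp only [Finset.prod_empty, one_mul] at h
    simp only [Finset.card_empty, Nat.le_zero, zeroCount, Multiset.card_eq_zero,
      Multiset.filter_eq_nil]
    exact fun x hx hxD => h x hxD (isRoot_of_mem_roots hx)
  | insert a T ha ih =>
    have hstep : bellMap ((X - C (α a)) * R) = X * derivative (bellMap R) + X * bellMap R -
        C (α a) * bellMap R := by
      rw [sub_mul, map_sub, bellMap_X_mul, ← smul_eq_C_mul, map_smul, smul_eq_C_mul]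
    rw [Finset.prod_insert ha, mul_comm (X - C (α a)), mul_assoc] at h
    have h2 := ih _ h
    rw [Finset.card_insert_of_notMem ha]
    -- If the image vanishes identically, so do all later ones, against the nonvanishing hypothesis
    -- at any point of the nonempty set `D`.
    by_cases hq : bellMap ((X - C (α a)) * R) = 0
    · have hz : ∀ S : Finset ℕ, bellMap ((∏ l ∈ S, (X - C (α l))) * ((X - C (α a)) * R)) = 0 := by
        intro S
        induction S using Finset.induction_on with
        | empty => simpa using hq
        | insert b S hb ihS =>
          rw [Finset.prod_insert hb, mul_assoc, sub_mul, map_sub, bellMap_X_mul, ← smul_eq_C_mul,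
            map_smul, ihS]
          simp
      obtain ⟨x, hx⟩ := hne
      exact absurd (by rw [hz]; simp) (h x hx)
    · rw [hstep] at hq h2
      exact (zeroCount_le_succ _ _ hD h0 hq).trans (Nat.add_le_add_right h2 1)


/-! ### Scaling and the two dominant terms -/

/-- The ratio `k q^k / (l q^l)` with `q = l / (l + 1)`. -/
noncomputable def termRatio (l k : ℕ) : ℝ :=
  (k : ℝ) * ((l : ℝ) / (l + 1)) ^ k / (l * ((l : ℝ) / (l + 1)) ^ l)

theorem termRatio_nonneg (l k : ℕ) : 0 ≤ termRatio l k := by unfold termRatio; positivity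

theorem termRatio_self {l : ℕ} (hl : 0 < l) : termRatio l l = 1 :=
  div_self (by positivity)

/-- The factor `l - k` shows unimodality with a plateau exactly at `l` and `l + 1`, which is the
reason for the base `l/(l+1)`. -/
theorem termRatio_succ_sub {l : ℕ} (hl : 0 < l) (k : ℕ) :
    termRatio l (k + 1) - termRatio l k =
      ((l : ℝ) / (l + 1)) ^ k / (l * ((l : ℝ) / (l + 1)) ^ l) / (l + 1) * ((l : ℝ) - k) := by
  have : (0 : ℝ) < l := by exact_mod_cast hl
  unfold termRatio
  rw [pow_succ]
  push_cast
  field_simp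
  ring

theorem termRatio_lt_succ {l : ℕ} (hl : 0 < l) {k : ℕ} (hk : k < l) :
    termRatio l k < termRatio l (k + 1) := by
  have h : (0 : ℝ) < l - k := sub_pos.2 (by exact_mod_cast hk)
  have h2 := termRatio_succ_sub hl k
  have : 0 < ((l : ℝ) / (l + 1)) ^ k / (l * ((l : ℝ) / (l + 1)) ^ l) / (l + 1) * ((l : ℝ) - k) := by
    positivity
  linarith

theorem termRatio_succ_lt {l : ℕ} (hl : 0 < l) {k : ℕ} (hk : l < k) :
    termRatio l (k + 1) < termRatio l k := by
  have h : (l : ℝ) - k < 0 := sub_neg.2 (by exact_mod_cast hk)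
  have h2 := termRatio_succ_sub hl k
  have := mul_neg_of_pos_of_neg (show 0 < ((l : ℝ) / (l + 1)) ^ k /
    (l * ((l : ℝ) / (l + 1)) ^ l) / (l + 1) by positivity) h
  linarith

theorem termRatio_self_succ {l : ℕ} (hl : 0 < l) : termRatio l (l + 1) = 1 := by
  have h := termRatio_succ_sub hl l
  rwa [sub_self, mul_zero, termRatio_self hl, sub_eq_zero] at h

theorem termRatio_lt_one {l : ℕ} (hl : 0 < l) {k : ℕ} (h1 : k ≠ l) (h2 : k ≠ l + 1) :
    termRatio l k < 1 := by
  rcases lt_or_gt_of_ne h1 with h | h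
  · rw [← termRatio_self hl]
    have : ∀ m, k + 1 ≤ m → m ≤ l → termRatio l k < termRatio l m := by
      intro m hm
      induction m, hm using Nat.le_induction with
      | base => exact fun _ => termRatio_lt_succ hl h
      | succ m _ ih => exact fun hml => (ih (by omega)).trans (termRatio_lt_succ hl hml)
    exact this l h le_rfl
  · rw [← termRatio_self_succ hl]
    have : ∀ m, l + 2 ≤ m → termRatio l m < termRatio l (l + 1) := by
      intro m hm
      induction m, hm using Nat.le_induction with
      | base => exact termRatio_succ_lt hl (Nat.lt_succ_self l)
      | succ m hm ih => exact (termRatio_succ_lt hl (by omega)).trans ih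
    exact this k (by omega)

theorem termRatio_le_one {l : ℕ} (hl : 0 < l) (k : ℕ) : termRatio l k ≤ 1 := by
  by_cases h1 : k = l
  · rw [h1, termRatio_self hl]
  by_cases h2 : k = l + 1
  · rw [h2, termRatio_self_succ hl]
  exact (termRatio_lt_one hl h1 h2).le

theorem pow_mul_scaled_pow {l : ℕ} (hl : 0 < l) (z : ℝ) (N k : ℕ) :
    (k : ℝ) ^ N * (z * ((l : ℝ) / (l + 1)) ^ N) ^ k =
      (l * ((l : ℝ) / (l + 1)) ^ l) ^ N * (termRatio l k ^ N * z ^ k) := by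
  have h : (l * ((l : ℝ) / (l + 1)) ^ l) ≠ 0 := by positivity
  rw [termRatio, div_pow ((k : ℝ) * _), ← mul_assoc, mul_div_cancel₀ _ (pow_ne_zero _ h), mul_pow, mul_pow,
    ← pow_mul, ← pow_mul, mul_comm N k]
  ring

/-- Coefficients merely dominated by `Q(k)` are allowed because `eventually_no_zero` applies this to
a minorant series. -/
theorem summable_scaled_bound {c : ℕ → ℝ} {Q : ℝ[X]} (hc : ∀ k, |c k| ≤ |Q.eval (k : ℝ)|)
    (z : ℝ) : Summable (fun k : ℕ => |c k * z ^ k / k.factorial|) := by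
  refine Summable.of_nonneg_of_le (fun _ => abs_nonneg _) (fun k => ?_)
    (hasSum_eval_mul_pow_div_factorial Q z).summable.abs
  rw [abs_div, abs_mul, abs_div, abs_mul]
  exact div_le_div_of_nonneg_right (mul_le_mul_of_nonneg_right (hc k) (abs_nonneg _))
    (abs_nonneg _)

theorem abs_scaled_le {l : ℕ} (hl : 0 < l) (c : ℕ → ℝ) (z : ℝ) (N k : ℕ) :
    |c k * (termRatio l k ^ N * z ^ k) / k.factorial| ≤ |c k * z ^ k / k.factorial| := by
  have h1 : |termRatio l k ^ N| ≤ 1 := by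
    rw [abs_pow, abs_of_nonneg (termRatio_nonneg l k)]
    exact pow_le_one₀ (termRatio_nonneg l k) (termRatio_le_one hl k)
  rw [abs_div, abs_mul, abs_mul, abs_div, abs_mul]
  gcongr
  exact mul_le_of_le_one_left (abs_nonneg _) h1

/-- After scaling only the two dominant terms survive. -/
theorem tendsto_tsum_scaled {l : ℕ} (hl : 0 < l) {c : ℕ → ℝ} {Q : ℝ[X]}
    (hc : ∀ k, |c k| ≤ |Q.eval (k : ℝ)|) (z : ℝ) :
    Tendsto (fun N : ℕ => ∑' k : ℕ, c k * (termRatio l k ^ N * z ^ k) / k.factorial) atTop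
      (𝓝 (c l * z ^ l / l.factorial + c (l + 1) * z ^ (l + 1) / (l + 1).factorial)) := by
  have hlim : c l * z ^ l / l.factorial + c (l + 1) * z ^ (l + 1) / (l + 1).factorial =
      ∑' k : ℕ, if k = l ∨ k = l + 1 then c k * z ^ k / k.factorial else 0 := by
    rw [tsum_eq_sum (s := {l, l + 1}), Finset.sum_pair (by omega)]
    · simp
    · intro k hk
      rw [if_neg (by simpa using hk)]
  rw [hlim]
  refine tendsto_tsum_of_dominated_convergence (summable_scaled_bound hc z) (fun k => ?_)
    (Eventually.of_forall fun N k => abs_scaled_le hl c z N k)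
  split_ifs with h
  · have h1 : termRatio l k = 1 := by
      rcases h with rfl | rfl
      · exact termRatio_self hl
      · exact termRatio_self_succ hl
    simp [h1]
  · push Not at h
    have h1 := tendsto_pow_atTop_nhds_zero_of_lt_one (termRatio_nonneg l k)
      (termRatio_lt_one hl h.1 h.2)
    simpa using ((h1.mul_const (z ^ k)).const_mul (c k)).div_const (k.factorial : ℝ)

theorem hasSum_bellMap_X_pow_mul (Q : ℝ[X]) (N : ℕ) (x : ℝ) :
    HasSum (fun k : ℕ => Q.eval (k : ℝ) * ((k : ℝ) ^ N * x ^ k) / k.factorial)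
      (Real.exp x * (bellMap (X ^ N * Q)).eval x) := by
  refine (hasSum_eval_mul_pow_div_factorial (X ^ N * Q) x).congr_fun fun k => ?_
  rw [eval_mul, eval_pow, eval_X]
  ring

/-- The prefactors are positive, so the polynomial has the sign of the scaled series. -/
theorem exp_mul_bellMap_scaled {l : ℕ} (hl : 0 < l) (Q : ℝ[X]) (z : ℝ) (N : ℕ) :
    Real.exp (z * ((l : ℝ) / (l + 1)) ^ N) *
        (bellMap (X ^ N * Q)).eval (z * ((l : ℝ) / (l + 1)) ^ N) =
      (l * ((l : ℝ) / (l + 1)) ^ l) ^ N *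
        ∑' k : ℕ, Q.eval (k : ℝ) * (termRatio l k ^ N * z ^ k) / k.factorial := by
  rw [← (hasSum_bellMap_X_pow_mul Q N _).tsum_eq, ← tsum_mul_left]
  refine tsum_congr fun k => ?_
  rw [pow_mul_scaled_pow hl]
  ring

/-! ### Zeros near the balance points -/

/-- The scaled position `-(l+1) Q(l) / Q(l+1)` of the zero where the terms `l` and `l + 1`
balance. -/
noncomputable def balancePoint (Q : ℝ[X]) (l : ℕ) : ℝ :=
  -((l + 1) * Q.eval (l : ℝ) / Q.eval ((l : ℝ) + 1))

theorem balancePoint_ne_zero {Q : ℝ[X]} {l : ℕ} (h1 : Q.eval (l : ℝ) ≠ 0)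
    (h2 : Q.eval ((l : ℝ) + 1) ≠ 0) : balancePoint Q l ≠ 0 :=
  neg_ne_zero.2 (div_ne_zero (mul_ne_zero (by positivity) h1) h2)

theorem tendsto_tsum_near_balancePoint {Q : ℝ[X]} {l : ℕ} (hl : 0 < l)
    (h2 : Q.eval ((l : ℝ) + 1) ≠ 0) (t : ℝ) :
    Tendsto (fun N : ℕ => ∑' k : ℕ, Q.eval (k : ℝ) *
        (termRatio l k ^ N * (balancePoint Q l * t) ^ k) / k.factorial) atTop
      (𝓝 ((balancePoint Q l * t) ^ l / l.factorial * Q.eval (l : ℝ) * (1 - t))) := by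
  have h := tendsto_tsum_scaled hl (c := fun k => Q.eval (k : ℝ)) (Q := Q) (fun _ => le_rfl)
    (balancePoint Q l * t)
  convert h using 2
  have h3 : (l.factorial : ℝ) ≠ 0 := by positivity
  rw [Nat.factorial_succ, pow_succ]
  push_cast
  have h4 : balancePoint Q l * Q.eval ((l : ℝ) + 1) = -((l + 1) * Q.eval (l : ℝ)) := by
    rw [balancePoint]; field_simp
  have h5 : Q.eval ((l : ℝ) + 1) * ((balancePoint Q l * t) ^ l * (balancePoint Q l * t)) /
      ((l + 1) * l.factorial) = (balancePoint Q l * t) ^ l * t *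
      (balancePoint Q l * Q.eval ((l : ℝ) + 1)) / ((l + 1) * l.factorial) := by ring
  rw [h5, h4]
  field_simp
  ring

/-- The limits at `t = 1 - ε` and `t = 1 + ε` have opposite signs, and the intermediate value
theorem applies; `ε < 1` keeps both points on the same side of `0`. -/
theorem eventually_exists_zero_near {Q : ℝ[X]} {l : ℕ} (hl : 0 < l)
    (h1 : Q.eval (l : ℝ) ≠ 0) (h2 : Q.eval ((l : ℝ) + 1) ≠ 0) {ε : ℝ} (hε : 0 < ε)
    (hε1 : ε < 1) :
    ∀ᶠ N : ℕ in atTop, bellMap (X ^ N * Q) ≠ 0 ∧ ∃ x : ℝ, (bellMap (X ^ N * Q)).eval x = 0 ∧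
      |x / (balancePoint Q l * ((l : ℝ) / (l + 1)) ^ N) - 1| < ε := by
  have hz := balancePoint_ne_zero h1 h2
  have hlim := (tendsto_tsum_near_balancePoint hl h2 (1 - ε)).mul
    (tendsto_tsum_near_balancePoint hl h2 (1 + ε))
  have hneg : (balancePoint Q l * (1 - ε)) ^ l / l.factorial * Q.eval (l : ℝ) * (1 - (1 - ε)) *
      ((balancePoint Q l * (1 + ε)) ^ l / l.factorial * Q.eval (l : ℝ) * (1 - (1 + ε))) < 0 := by
    have h3 : 0 < 1 - ε := by linarith
    have h4 : 0 < (balancePoint Q l ^ l * Q.eval (l : ℝ) / l.factorial * ε) ^ 2 *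
        ((1 - ε) ^ l * (1 + ε) ^ l) := by positivity
    rw [mul_pow, mul_pow]
    have h5 : balancePoint Q l ^ l * (1 - ε) ^ l / l.factorial * Q.eval (l : ℝ) * (1 - (1 - ε)) *
        (balancePoint Q l ^ l * (1 + ε) ^ l / l.factorial * Q.eval (l : ℝ) * (1 - (1 + ε))) =
        -((balancePoint Q l ^ l * Q.eval (l : ℝ) / l.factorial * ε) ^ 2 *
        ((1 - ε) ^ l * (1 + ε) ^ l)) := by ring
    rw [h5]
    exact neg_lt_zero.2 h4
  filter_upwards [hlim.eventually_lt_const hneg] with N hN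
  set q : ℝ := (l : ℝ) / (l + 1) with hq
  have hq0 : 0 < q := by positivity
  set z := balancePoint Q l
  set p := bellMap (X ^ N * Q)
  have hD : 0 < (l * q ^ l) ^ N := by positivity
  have e1 := exp_mul_bellMap_scaled hl Q (z * (1 - ε)) N
  have e2 := exp_mul_bellMap_scaled hl Q (z * (1 + ε)) N
  rw [← hq] at e1 e2
  have hprod : p.eval (z * (1 - ε) * q ^ N) * p.eval (z * (1 + ε) * q ^ N) < 0 := by
    have h5 : (Real.exp (z * (1 - ε) * q ^ N) * p.eval (z * (1 - ε) * q ^ N)) *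
        (Real.exp (z * (1 + ε) * q ^ N) * p.eval (z * (1 + ε) * q ^ N)) < 0 := by
      rw [e1, e2, mul_mul_mul_comm]
      exact mul_neg_of_pos_of_neg (mul_pos hD hD) hN
    rw [mul_mul_mul_comm] at h5
    exact neg_of_mul_neg_right h5 (by positivity)
  refine ⟨fun h => by rw [h] at hprod; simp at hprod, ?_⟩
  have hcont : ContinuousOn (fun t => p.eval (z * t * q ^ N)) (Set.Icc (1 - ε) (1 + ε)) := by
    have : Continuous (fun t => p.eval (z * t * q ^ N)) := by fun_prop
    exact this.continuousOn
  have hle : 1 - ε ≤ 1 + ε := by linarith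
  obtain ⟨t, ht, ht0⟩ : ∃ t ∈ Set.Ioo (1 - ε) (1 + ε), p.eval (z * t * q ^ N) = 0 := by
    rcases mul_neg_iff.1 hprod with h | h
    · exact intermediate_value_Ioo' hle hcont ⟨h.2, h.1⟩
    · exact intermediate_value_Ioo hle hcont ⟨h.1, h.2⟩
  refine ⟨_, ht0, ?_⟩
  have h6 : z * t * q ^ N / (z * q ^ N) = t := by field_simp
  rw [h6, abs_lt]
  exact ⟨by linarith [ht.1], by linarith [ht.2]⟩

/-- Choosing the element with `g N x` nearest to `1` gives one sequence that works for every `ε`,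
without a diagonal argument. -/
theorem exists_tendsto_of_eventually_exists_near {s : ℕ → Finset ℝ} {g : ℕ → ℝ → ℝ}
    (h : ∀ ε > 0, ε < 1 → ∀ᶠ N in atTop, ∃ x ∈ s N, |g N x - 1| < ε) :
    ∃ r : ℕ → ℝ, (∀ᶠ N in atTop, r N ∈ s N) ∧ Tendsto (fun N => g N (r N)) atTop (𝓝 1) := by
  have hmin : ∀ N, ∃ r, (s N).Nonempty → r ∈ s N ∧ ∀ x ∈ s N, |g N r - 1| ≤ |g N x - 1| := by
    intro N
    by_cases hN : (s N).Nonempty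
    · obtain ⟨r, hr⟩ := Finset.exists_min_image (s N) (fun x => |g N x - 1|) hN
      exact ⟨r, fun _ => hr⟩
    · exact ⟨0, fun h => absurd h hN⟩
  choose r hr using hmin
  refine ⟨r, ?_, ?_⟩
  · filter_upwards [h (1 / 2) (by norm_num) (by norm_num)] with N ⟨x, hx, _⟩
    exact (hr N ⟨x, hx⟩).1
  · rw [Metric.tendsto_nhds]
    intro ε hε
    have hm : min ε (1 / 2) < 1 := (min_le_right _ _).trans_lt (by norm_num)
    filter_upwards [h (min ε (1 / 2)) (by positivity) hm] with N ⟨x, hx, hx'⟩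
    rw [Real.dist_eq]
    exact (((hr N ⟨x, hx⟩).2 x hx).trans_lt hx').trans_le (min_le_left _ _)

theorem exists_zero_sequence {Q : ℝ[X]} {l : ℕ} (hl : 0 < l)
    (h1 : Q.eval (l : ℝ) ≠ 0) (h2 : Q.eval ((l : ℝ) + 1) ≠ 0) :
    ∃ r : ℕ → ℝ, (∀ᶠ N in atTop, r N ∈ (bellMap (X ^ N * Q)).roots) ∧
      Tendsto (fun N => r N / (balancePoint Q l * ((l : ℝ) / (l + 1)) ^ N)) atTop (𝓝 1) := by
  obtain ⟨r, hr, hlim⟩ := exists_tendsto_of_eventually_exists_near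
    (s := fun N => (bellMap (X ^ N * Q)).roots.toFinset)
    (g := fun N x => x / (balancePoint Q l * ((l : ℝ) / (l + 1)) ^ N)) fun ε hε hε1 => by
      filter_upwards [eventually_exists_zero_near hl h1 h2 hε hε1] with N ⟨hne, x, hx, hx'⟩
      exact ⟨x, Multiset.mem_toFinset.2 ((mem_roots hne).2 hx), hx'⟩
  exact ⟨r, by simpa using hr, hlim⟩

/-! ### Zero-free regions -/

/-- If the first `l` coefficients have one sign at points of sign `σ`, there are no zeros of that
sign below the scale at which the term `l + 1` becomes dominant. -/
theorem eventually_no_zero {W : ℝ[X]} {σ : ℝ} (hσ : |σ| = 1) {l : ℕ} (hl : 0 < l)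
    (hW : ∀ k : ℕ, 0 < k → k ≤ l →
      0 < W.eval (k : ℝ) * σ ^ k * (W.eval (l : ℝ) * σ ^ l)) :
    ∃ y > 0, ∀ᶠ N : ℕ in atTop, ∀ x : ℝ, 0 < σ * x → σ * x ≤ y * ((l : ℝ) / (l + 1)) ^ N →
      (bellMap (X ^ N * W)).eval x ≠ 0 := by
  set τ := W.eval (l : ℝ) * σ ^ l with hτ
  have hτ0 : τ ≠ 0 := fun h => by have := hW l hl le_rfl; rw [h, mul_zero] at this; exact this.false
  have hτa : |τ| = |W.eval (l : ℝ)| := by rw [hτ, abs_mul, abs_pow, hσ, one_pow, mul_one]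
  have hWl : 0 < |W.eval (l : ℝ)| := hτa ▸ abs_pos.2 hτ0
  set q : ℝ := (l : ℝ) / (l + 1) with hq
  have hq0 : 0 < q := by positivity
  -- Coefficients of a minorant: the favourable terms below `l` are dropped, the term `l` is kept,
  -- and all later terms are counted as adverse.
  set c : ℕ → ℝ := fun k => if k < l then 0 else if k = l then |W.eval (k : ℝ)| else
    -|W.eval (k : ℝ)| with hcdef
  have hc : ∀ k, |c k| ≤ |W.eval (k : ℝ)| := by
    intro k
    simp only [hcdef]
    split_ifs <;> simp
  have hcl : c l = |W.eval (l : ℝ)| := by simp [hcdef]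
  have hcl1 : c (l + 1) = -|W.eval ((l : ℝ) + 1)| := by simp [hcdef]
  -- Small enough for the term `l` to beat the term `l + 1` in the limit; the `+ 1` avoids a
  -- division by zero.
  set y := |W.eval (l : ℝ)| / (|W.eval ((l : ℝ) + 1)| + 1) with hy
  have hy0 : 0 < y := by positivity
  refine ⟨y, hy0, ?_⟩
  have hlim := tendsto_tsum_scaled hl hc y
  have hpos : 0 < c l * y ^ l / l.factorial + c (l + 1) * y ^ (l + 1) / (l + 1).factorial := by
    rw [hcl, hcl1, Nat.factorial_succ, pow_succ]
    push_cast
    have h1 : y * (|W.eval ((l : ℝ) + 1)| + 1) = |W.eval (l : ℝ)| := by rw [hy]; field_simp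
    have h2 : |W.eval (l : ℝ)| * y ^ l / l.factorial +
        -|W.eval ((l : ℝ) + 1)| * (y ^ l * y) / ((l + 1) * l.factorial) =
        y ^ l / ((l + 1) * l.factorial) * (l * |W.eval (l : ℝ)| + y) := by
      field_simp
      linear_combination -h1
    rw [h2]
    positivity
  filter_upwards [hlim.eventually_const_lt hpos, eventually_gt_atTop 0] with N hN hN0
  intro x hx hxy hzero
  set u := σ * x with hu
  set ρ := y * q ^ N with hρ
  have hρ0 : 0 < ρ := by positivity
  have hσ2 : σ * σ = 1 := by rw [← abs_mul_abs_self, hσ, one_mul]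
  have hxu : x = σ * u := by rw [hu, ← mul_assoc, hσ2, one_mul]
  have hD : 0 < (l * q ^ l) ^ N := by positivity
  have hsum1 := (hasSum_bellMap_X_pow_mul W N x).mul_left τ
  rw [hzero, mul_zero, mul_zero] at hsum1
  have hsummable : Summable fun k : ℕ => c k * (termRatio l k ^ N * y ^ k) / k.factorial :=
    ((summable_scaled_bound hc y).of_nonneg_of_le (fun _ => abs_nonneg _)
      (fun k => abs_scaled_le hl c y N k)).of_abs
  -- The minorant at the endpoint `ρ`, times `(u/ρ)^l`, controls every `u ≤ ρ`, since `u^k ≤ (u/ρ)^l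
  -- ρ^k` for `k ≥ l`.
  have hsum2 := hsummable.hasSum.mul_left (|τ| * (u / ρ) ^ l * (l * q ^ l) ^ N)
  have hle := hasSum_le (fun k => ?_) hsum2 hsum1
  · have : 0 < |τ| * (u / ρ) ^ l * (l * q ^ l) ^ N *
        ∑' k : ℕ, c k * (termRatio l k ^ N * y ^ k) / k.factorial := by positivity
    exact absurd hle (not_le.2 this)
  · have e1 : |τ| * (u / ρ) ^ l * (l * q ^ l) ^ N *
        (c k * (termRatio l k ^ N * y ^ k) / k.factorial) =
        |τ| * c k * (k : ℝ) ^ N * ((u / ρ) ^ l * ρ ^ k) / k.factorial := by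
      have := pow_mul_scaled_pow hl y N k
      rw [← hq, ← hρ] at this
      linear_combination (-(|τ| * (u / ρ) ^ l * c k / k.factorial)) * this
    have e2 : τ * (W.eval (k : ℝ) * ((k : ℝ) ^ N * x ^ k) / k.factorial) =
        W.eval (k : ℝ) * σ ^ k * τ * (k : ℝ) ^ N * u ^ k / k.factorial := by
      rw [hxu, mul_pow]; ring
    rw [e1, e2]
    gcongr ?_ / _
    rcases lt_trichotomy k l with h | h | h
    · have hck : c k = 0 := by simp [hcdef, h]
      rw [hck]
      rcases Nat.eq_zero_or_pos k with h0 | h0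
      -- The sign hypothesis omits `k = 0`; that term vanishes because `0^N = 0` for `N > 0`.
      · simp [h0, hN0.ne']
      · have := hW k h0 h.le
        have h3 : 0 ≤ W.eval (k : ℝ) * σ ^ k * τ * (k : ℝ) ^ N * u ^ k := by positivity
        simpa using h3
    · subst h
      have h4 : (u / ρ) ^ k * ρ ^ k = u ^ k := by
        rw [← mul_pow, div_mul_cancel₀ _ hρ0.ne']
      have h5 : W.eval (k : ℝ) * σ ^ k * τ = |τ| * c k := by
        rw [hcl, ← hτa, ← hτ, abs_mul_abs_self]
      rw [h4, h5]
    · have hck : c k = -|W.eval (k : ℝ)| := by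
        simp [hcdef, h.not_gt, h.ne']
      have h4 : u ^ k ≤ (u / ρ) ^ l * ρ ^ k := by
        have h6 : (u / ρ) ^ k ≤ (u / ρ) ^ l :=
          pow_le_pow_of_le_one (by positivity) ((div_le_one hρ0).2 hxy) h.le
        calc u ^ k = (u / ρ) ^ k * ρ ^ k := by rw [← mul_pow, div_mul_cancel₀ _ hρ0.ne']
          _ ≤ _ := by gcongr
      have h5 : -(|W.eval (k : ℝ)| * |τ|) ≤ W.eval (k : ℝ) * σ ^ k * τ := by
        have h7 : |W.eval (k : ℝ)| * |τ| = |W.eval (k : ℝ) * σ ^ k * τ| := by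
          rw [abs_mul (W.eval (k : ℝ) * σ ^ k) τ, abs_mul (W.eval (k : ℝ)), abs_pow, hσ, one_pow,
            mul_one]
        rw [h7]
        exact neg_abs_le _
      rw [hck]
      calc |τ| * -|W.eval (k : ℝ)| * (k : ℝ) ^ N * ((u / ρ) ^ l * ρ ^ k)
          = -(|W.eval (k : ℝ)| * |τ| * (k : ℝ) ^ N * ((u / ρ) ^ l * ρ ^ k)) := by ring
        _ ≤ -(|W.eval (k : ℝ)| * |τ| * (k : ℝ) ^ N * u ^ k) := by gcongr
        _ = -(|W.eval (k : ℝ)| * |τ|) * ((k : ℝ) ^ N * u ^ k) := by ring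
        _ ≤ W.eval (k : ℝ) * σ ^ k * τ * ((k : ℝ) ^ N * u ^ k) := by gcongr
        _ = _ := by ring

/-- If all coefficients have one sign at points of sign `σ`, there are no zeros of that sign. -/
theorem no_zero_of_forall_pos {W : ℝ[X]} {σ : ℝ} (hσ : |σ| = 1) {l : ℕ} (hl : 0 < l)
    (hW : ∀ k : ℕ, 0 < k → 0 < W.eval (k : ℝ) * σ ^ k * (W.eval (l : ℝ) * σ ^ l))
    {N : ℕ} (hN : 0 < N) {x : ℝ} (hx : 0 < σ * x) : (bellMap (X ^ N * W)).eval x ≠ 0 := by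
  intro hzero
  set τ := W.eval (l : ℝ) * σ ^ l with hτ
  have hσ2 : σ * σ = 1 := by rw [← abs_mul_abs_self, hσ, one_mul]
  have hxu : x = σ * (σ * x) := by rw [← mul_assoc, hσ2, one_mul]
  have hsum := (hasSum_bellMap_X_pow_mul W N x).mul_left τ
  rw [hzero, mul_zero, mul_zero] at hsum
  have e2 : ∀ k : ℕ, τ * (W.eval (k : ℝ) * ((k : ℝ) ^ N * x ^ k) / k.factorial) =
      W.eval (k : ℝ) * σ ^ k * τ * (k : ℝ) ^ N * (σ * x) ^ k / k.factorial := by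
    intro k
    nth_rewrite 1 [hxu]
    rw [mul_pow]; ring
  have hnonneg : ∀ k : ℕ, 0 ≤ τ * (W.eval (k : ℝ) * ((k : ℝ) ^ N * x ^ k) / k.factorial) := by
    intro k
    rw [e2]
    rcases Nat.eq_zero_or_pos k with h0 | h0
    · simp [h0, hN.ne']
    · have := hW k h0
      positivity
  have h1 := le_hasSum hsum l fun k _ => hnonneg k
  rw [e2] at h1
  have := hW l hl
  have : 0 < W.eval (l : ℝ) * σ ^ l * τ * (l : ℝ) ^ N * (σ * x) ^ l / l.factorial := by positivity
  linarith


/-! ### Removing sign changes from the symbol -/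

/-- The polynomial `∏ (X - (l + 1/2))` over `l ∈ T`. -/
noncomputable def midpointPoly (T : Finset ℕ) : ℝ[X] := ∏ l ∈ T, (X - C ((l : ℝ) + 1 / 2))

/-- Only the factor with root `k + 1/2` changes sign between `k` and `k + 1`. -/
theorem eval_midpointPoly_mul_succ (T : Finset ℕ) (k : ℕ) :
    0 < (if k ∈ T then -1 else 1) *
      ((midpointPoly T).eval (k : ℝ) * (midpointPoly T).eval ((k : ℝ) + 1)) := by
  classical
  have hother : ∀ T' : Finset ℕ, k ∉ T' →
      0 < (midpointPoly T').eval (k : ℝ) * (midpointPoly T').eval ((k : ℝ) + 1) := by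
    intro T' hk
    rw [midpointPoly, eval_prod, eval_prod, ← Finset.prod_mul_distrib]
    refine Finset.prod_pos fun l hl => ?_
    simp only [eval_sub, eval_X, eval_C]
    rcases lt_or_gt_of_ne (show l ≠ k from fun h => hk (h ▸ hl)) with h | h
    · have : (l : ℝ) + 1 ≤ k := by exact_mod_cast h
      exact mul_pos (by linarith) (by linarith)
    · have : (k : ℝ) + 1 ≤ l := by exact_mod_cast h
      exact mul_pos_of_neg_of_neg (by linarith) (by linarith)
  split_ifs with hk
  · have h := hother (T.erase k) (Finset.notMem_erase k T)
    have hfac : midpointPoly T = (X - C ((k : ℝ) + 1 / 2)) * midpointPoly (T.erase k) :=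
      (Finset.mul_prod_erase T _ hk).symm
    rw [hfac]
    simp only [eval_mul, eval_sub, eval_X, eval_C]
    nlinarith [h]
  · simpa using hother T hk

theorem mul_pos_of_forall_mul_succ_pos {a : ℕ → ℝ} {i j : ℕ} (hij : i ≤ j) (h0 : a i ≠ 0)
    (h : ∀ k, i ≤ k → k < j → 0 < a k * a (k + 1)) : 0 < a i * a j := by
  induction j, hij using Nat.le_induction with
  | base => exact mul_self_pos.2 h0
  | succ j hij ih =>
    have h1 := ih fun k hk hkj => h k hk (hkj.trans (Nat.lt_succ_self j))
    have h2 := h j hij (Nat.lt_succ_self j)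
    have h3 : 0 < (a i * a (j + 1)) * (a j * a j) := by
      have := mul_pos h1 h2
      linarith
    exact pos_of_mul_pos_left h3 (mul_self_nonneg _)

/-- Multiplication by `midpointPoly T` removes the sign changes that lie in `T`. -/
theorem signs_midpointPoly_mul {P : ℝ[X]} (hP : ∀ m : ℕ, 0 < m → P.eval (m : ℝ) ≠ 0) {σ : ℝ}
    (hσ : |σ| = 1) {T : Finset ℕ} {i j : ℕ} (hi : 0 < i) (hij : i ≤ j)
    (hT : ∀ k : ℕ, i ≤ k → k < j → (k ∈ T ↔ σ * (P.eval (k : ℝ) * P.eval ((k : ℝ) + 1)) < 0)) :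
    0 < (midpointPoly T * P).eval (i : ℝ) * σ ^ i * ((midpointPoly T * P).eval (j : ℝ) * σ ^ j) := by
  have hσ2 : σ * σ = 1 := by rw [← abs_mul_abs_self, hσ, one_mul]
  have hσ0 : σ ≠ 0 := fun h => by simp [h] at hσ
  refine mul_pos_of_forall_mul_succ_pos (a := fun k : ℕ => (midpointPoly T * P).eval (k : ℝ) * σ ^ k)
    hij ?_ fun k hik hkj => ?_
  · have h := eval_midpointPoly_mul_succ T i
    have h1 : (midpointPoly T).eval (i : ℝ) ≠ 0 := fun h2 => by simp [h2] at h
    rw [eval_mul]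
    exact mul_ne_zero (mul_ne_zero h1 (hP i hi)) (pow_ne_zero _ hσ0)
  · have h := eval_midpointPoly_mul_succ T k
    have h1 : σ * (P.eval (k : ℝ) * P.eval ((k : ℝ) + 1)) ≠ 0 :=
      mul_ne_zero hσ0 (mul_ne_zero (hP k (hi.trans_le hik))
        (by simpa using hP (k + 1) k.succ_pos))
    have h2 : (midpointPoly T * P).eval (k : ℝ) * σ ^ k *
        ((midpointPoly T * P).eval ((k + 1 : ℕ) : ℝ) * σ ^ (k + 1)) =
        ((midpointPoly T).eval (k : ℝ) * (midpointPoly T).eval ((k : ℝ) + 1)) *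
          (σ * (P.eval (k : ℝ) * P.eval ((k : ℝ) + 1))) := by
      have h3 : σ ^ k * σ ^ k = 1 := by rw [← mul_pow, hσ2, one_pow]
      rw [eval_mul, eval_mul, pow_succ]
      push_cast
      linear_combination ((midpointPoly T).eval (k : ℝ) * (midpointPoly T).eval ((k : ℝ) + 1)) *
          (σ * (P.eval (k : ℝ) * P.eval ((k : ℝ) + 1))) * h3
    rw [h2]
    by_cases hk : k ∈ T
    · rw [if_pos hk] at h
      exact mul_pos_of_neg_of_neg (by linarith) ((hT k hik hkj).1 hk)
    · rw [if_neg hk, one_mul] at h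
      exact mul_pos h (lt_of_le_of_ne (not_lt.1 fun h3 => hk ((hT k hik hkj).2 h3)) h1.symm)

theorem zeroCount_bellMap_le_card {P : ℝ[X]} (T : Finset ℕ) (N : ℕ) {D : Set ℝ}
    (hD : D.OrdConnected) (h0 : 0 ∉ D) (hne : D.Nonempty)
    (h : ∀ x ∈ D, (bellMap (X ^ N * (midpointPoly T * P))).eval x ≠ 0) :
    zeroCount (bellMap (X ^ N * P)) D ≤ T.card := by
  refine zeroCount_bellMap_le T (fun l => (l : ℝ) + 1 / 2) _ hD h0 hne ?_
  have h1 : (∏ l ∈ T, (X - C ((l : ℝ) + 1 / 2))) * (X ^ N * P) = X ^ N * (midpointPoly T * P) := by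
    rw [midpointPoly]; ring
  rwa [h1]

/-! ### Matching the zeros found with the upper bound -/

theorem abs_eq_one_cases {σ : ℝ} (hσ : |σ| = 1) : σ = 1 ∨ σ = -1 :=
  (abs_eq zero_le_one).1 hσ

theorem ordConnected_signed_Ioc {σ : ℝ} (hσ : |σ| = 1) (ρ : ℝ) :
    Set.OrdConnected {x : ℝ | 0 < σ * x ∧ σ * x ≤ ρ} := by
  refine ⟨fun x hx y hy z hz => ?_⟩
  simp only [Set.mem_ofPred_eq, Set.mem_Icc] at *
  rcases abs_eq_one_cases hσ with rfl | rfl <;> constructor <;> linarith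

theorem ordConnected_signed_Ioi {σ : ℝ} (hσ : |σ| = 1) :
    Set.OrdConnected {x : ℝ | 0 < σ * x} := by
  refine ⟨fun x hx y hy z hz => ?_⟩
  simp only [Set.mem_ofPred_eq, Set.mem_Icc] at *
  rcases abs_eq_one_cases hσ with rfl | rfl <;> linarith

/-- Distinct known roots form a submultiset; the bound on the total count forces equality of
multisets, hence also simplicity. -/
theorem filter_roots_eq_map {p : ℝ[X]} {q : ℝ → Prop} [DecidablePred q] {T : Finset ℕ} {r : ℕ → ℝ}
    (hinj : Set.InjOn r T) (hr : ∀ l ∈ T, r l ∈ p.roots) (hrq : ∀ l ∈ T, q (r l))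
    (hcount : zeroCount p {x | q x} ≤ T.card) : p.roots.filter q = T.val.map r := by
  symm
  refine Multiset.eq_of_le_of_card_le ?_ ?_
  · refine (Multiset.le_iff_subset (Multiset.Nodup.map_on hinj T.nodup)).2 fun x hx => ?_
    obtain ⟨l, hl, rfl⟩ := Multiset.mem_map.1 hx
    exact Multiset.mem_filter.2 ⟨hr l hl, hrq l hl⟩
  · rw [Multiset.card_map, Finset.card_val]
    refine le_trans (le_of_eq ?_) hcount
    rw [zeroCount]
    congr!

theorem rootMultiplicity_eq_one {p : ℝ[X]} {q : ℝ → Prop} [DecidablePred q] {T : Finset ℕ} {r : ℕ → ℝ}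
    (hinj : Set.InjOn r T) (h : p.roots.filter q = T.val.map r) {x : ℝ}
    (hx : x ∈ p.roots) (hxq : q x) : p.rootMultiplicity x = 1 := by
  rw [← count_roots, ← Multiset.count_filter_of_pos (p := q) hxq]
  refine Multiset.count_eq_one_of_mem ?_ (Multiset.mem_filter.2 ⟨hx, hxq⟩)
  rw [h]
  exact Multiset.Nodup.map_on hinj T.nodup

theorem exists_zero_sequences {P : ℝ[X]} (hP : ∀ m : ℕ, 0 < m → P.eval (m : ℝ) ≠ 0) :
    ∃ r : ℕ → ℕ → ℝ, ∀ l, 0 < l → (∀ᶠ N in atTop, r l N ∈ (bellMap (X ^ N * P)).roots) ∧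
      Tendsto (fun N => r l N / (balancePoint P l * ((l : ℝ) / (l + 1)) ^ N)) atTop (𝓝 1) := by
  have h : ∀ l : ℕ, ∃ r : ℕ → ℝ, 0 < l → (∀ᶠ N in atTop, r N ∈ (bellMap (X ^ N * P)).roots) ∧
      Tendsto (fun N => r N / (balancePoint P l * ((l : ℝ) / (l + 1)) ^ N)) atTop (𝓝 1) := by
    intro l
    by_cases hl : 0 < l
    · obtain ⟨r, hr⟩ := exists_zero_sequence hl (hP l hl) (by simpa using hP (l + 1) l.succ_pos)
      exact ⟨r, fun _ => hr⟩
    · exact ⟨0, fun h => absurd h hl⟩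
  choose r hr using h
  exact ⟨r, hr⟩

/-- A sequence at the scale `(l/(l+1))^N` is negligible at a larger scale. -/
theorem eventually_lt_scale {r : ℕ → ℝ} {l m : ℕ} (hl : 0 < l) (hlm : l < m) {z : ℝ} (hz : z ≠ 0)
    (h : Tendsto (fun N => r N / (z * ((l : ℝ) / (l + 1)) ^ N)) atTop (𝓝 1)) (σ : ℝ) {y : ℝ}
    (hy : 0 < y) : ∀ᶠ N in atTop, σ * r N < y * ((m : ℝ) / (m + 1)) ^ N := by
  have hl' : (0 : ℝ) < l := by exact_mod_cast hl
  have hm' : (0 : ℝ) < m := by exact_mod_cast hl.trans hlm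
  have hlm' : (l : ℝ) < m := by exact_mod_cast hlm
  obtain ⟨q, hqd⟩ : ∃ q : ℝ, q = (l : ℝ) / (l + 1) := ⟨_, rfl⟩
  obtain ⟨q', hqd'⟩ : ∃ q' : ℝ, q' = (m : ℝ) / (m + 1) := ⟨_, rfl⟩
  have hq : 0 < q := by rw [hqd]; positivity
  have hq' : 0 < q' := by rw [hqd']; positivity
  have hqq : q / q' < 1 := by
    rw [div_lt_one hq', hqd, hqd', div_lt_div_iff₀ (by positivity) (by positivity)]
    linarith
  rw [← hqd] at h
  rw [← hqd']
  have h1 := (h.mul (tendsto_pow_atTop_nhds_zero_of_lt_one (by positivity) hqq)).const_mul (σ * z)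
  rw [mul_zero, mul_zero] at h1
  filter_upwards [h1.eventually_lt_const hy] with N hN
  have h2 : σ * z * (r N / (z * q ^ N) * (q / q') ^ N) = σ * r N / q' ^ N := by
    rw [div_pow q]
    have : q ^ N ≠ 0 := by positivity
    field_simp
  rwa [h2, div_lt_iff₀ (by positivity)] at hN

theorem eventually_scale_lt {r : ℕ → ℝ} {l : ℕ} (hl : 0 < l) {z σ : ℝ} (hz : 0 < σ * z)
    (h : Tendsto (fun N => r N / (z * ((l : ℝ) / (l + 1)) ^ N)) atTop (𝓝 1)) :
    ∀ᶠ N in atTop, σ * z / 2 * ((l : ℝ) / (l + 1)) ^ N < σ * r N := by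
  have hz0 : z ≠ 0 := fun h => by simp [h] at hz
  filter_upwards [h.eventually_const_lt (show (1 / 2 : ℝ) < 1 by norm_num)] with N hN
  have hq : 0 < ((l : ℝ) / (l + 1)) ^ N := by positivity
  have h1 : σ * r N = σ * z * ((l : ℝ) / (l + 1)) ^ N *
      (r N / (z * ((l : ℝ) / (l + 1)) ^ N)) := by field_simp
  rw [h1]
  nlinarith [mul_lt_mul_of_pos_left hN (mul_pos hz hq)]

theorem signed_balancePoint_pos {P : ℝ[X]} {σ : ℝ} {l : ℕ}
    (h : σ * (P.eval (l : ℝ) * P.eval ((l : ℝ) + 1)) < 0) : 0 < σ * balancePoint P l := by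
  have h0 : P.eval ((l : ℝ) + 1) ≠ 0 := fun h0 => by simp [h0] at h
  have h1 : σ * balancePoint P l = (l + 1) * -(σ * (P.eval (l : ℝ) * P.eval ((l : ℝ) + 1))) /
      (P.eval ((l : ℝ) + 1)) ^ 2 := by
    rw [balancePoint]; field_simp
  have h2 := neg_pos.2 h
  rw [h1]
  positivity

/-- As `l/(l+1)` increases with `l`, the zero attached to a smaller `l` is eventually much closer to
the origin. -/
theorem eventually_strictMonoOn {P : ℝ[X]} {σ : ℝ} {r : ℕ → ℕ → ℝ}
    (hr : ∀ l, 0 < l →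
      Tendsto (fun N => r l N / (balancePoint P l * ((l : ℝ) / (l + 1)) ^ N)) atTop (𝓝 1))
    {T : Finset ℕ} (hT : ∀ l ∈ T, 0 < l ∧ σ * (P.eval (l : ℝ) * P.eval ((l : ℝ) + 1)) < 0) :
    ∀ᶠ N in atTop, StrictMonoOn (fun l => σ * r l N) (T : Set ℕ) := by
  have h : ∀ l ∈ T, ∀ m ∈ T, ∀ᶠ N in atTop, l < m → σ * r l N < σ * r m N := by
    intro l hl m hm
    by_cases hlm : l < m
    · have hzl := signed_balancePoint_pos (hT l hl).2
      have hzm := signed_balancePoint_pos (hT m hm).2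
      filter_upwards [eventually_lt_scale (hT l hl).1 hlm
        (fun h => by simp [h] at hzl) (hr l (hT l hl).1) σ (half_pos hzm),
        eventually_scale_lt (hT m hm).1 hzm (hr m (hT m hm).1)] with N h1 h2 _
      exact h1.trans h2
    · exact Eventually.of_forall fun _ h => absurd h hlm
  have h2 := (Filter.eventually_all_finset T).2 fun l hl =>
    (Filter.eventually_all_finset T).2 fun m hm => h l hl m hm
  filter_upwards [h2] with N hN l hl m hm hlm
  exact hN l hl m hm hlm

theorem eventually_signed_pos {P : ℝ[X]} {σ : ℝ} {r : ℕ → ℕ → ℝ}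
    (hr : ∀ l, 0 < l →
      Tendsto (fun N => r l N / (balancePoint P l * ((l : ℝ) / (l + 1)) ^ N)) atTop (𝓝 1))
    {T : Finset ℕ} (hT : ∀ l ∈ T, 0 < l ∧ σ * (P.eval (l : ℝ) * P.eval ((l : ℝ) + 1)) < 0) :
    ∀ᶠ N in atTop, ∀ l ∈ T, 0 < σ * r l N := by
  refine (Filter.eventually_all_finset T).2 fun l hl => ?_
  have hz := signed_balancePoint_pos (hT l hl).2
  filter_upwards [eventually_scale_lt (hT l hl).1 hz (hr l (hT l hl).1)] with N hN
  exact lt_trans (by have := (hT l hl).1; positivity) hN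

theorem injOn_of_strictMonoOn_mul {σ : ℝ} {f : ℕ → ℝ} {T : Set ℕ}
    (h : StrictMonoOn (fun l => σ * f l) T) : Set.InjOn f T :=
  fun _ ha _ hb hab => h.injOn ha hb (by simp only [hab])

/-- The zeros of sign `σ` nearest to the origin. -/
theorem eventually_filter_roots_near {P : ℝ[X]} (hP : ∀ m : ℕ, 0 < m → P.eval (m : ℝ) ≠ 0) {σ : ℝ}
    (hσ : |σ| = 1) {r : ℕ → ℕ → ℝ}
    (hroot : ∀ l, 0 < l → ∀ᶠ N in atTop, r l N ∈ (bellMap (X ^ N * P)).roots)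
    (hr : ∀ l, 0 < l →
      Tendsto (fun N => r l N / (balancePoint P l * ((l : ℝ) / (l + 1)) ^ N)) atTop (𝓝 1))
    {T : Finset ℕ} {M : ℕ}
    (hT : ∀ l, l ∈ T ↔ l ≤ M ∧ 0 < l ∧ σ * (P.eval (l : ℝ) * P.eval ((l : ℝ) + 1)) < 0) :
    ∀ᶠ N in atTop, ∃ ρ : ℝ,
      (bellMap (X ^ N * P)).roots.filter (fun x => 0 < σ * x ∧ σ * x ≤ ρ) =
        T.val.map (fun l => r l N) := by
  have hT' : ∀ l ∈ T, 0 < l ∧ σ * (P.eval (l : ℝ) * P.eval ((l : ℝ) + 1)) < 0 :=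
    fun l hl => ((hT l).1 hl).2
  -- Cancelling the changes at `k ≤ M` fixes the signs up to `M + 1`, so the zero-free region
  -- reaches scale `M + 1`, beyond all zeros indexed by `T`.
  obtain ⟨y, hy, hno⟩ := eventually_no_zero (W := midpointPoly T * P) hσ M.succ_pos
    fun k hk hkM => signs_midpointPoly_mul hP hσ hk hkM fun i hi hiM => by
      rw [hT]
      exact ⟨fun h => h.2.2, fun h => ⟨by omega, by omega, h⟩⟩
  have hroot' := (Filter.eventually_all_finset T).2 fun l hl => hroot l (hT' l hl).1
  have hsmall := (Filter.eventually_all_finset T).2 fun l hl =>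
    eventually_lt_scale (hT' l hl).1 (Nat.lt_succ_of_le ((hT l).1 hl).1)
      (fun h => by simpa [h] using signed_balancePoint_pos (hT' l hl).2) (hr l (hT' l hl).1) σ hy
  filter_upwards [hno, hroot', hsmall, eventually_strictMonoOn hr hT', eventually_signed_pos hr hT']
    with N h1 h2 h3 h4 h5
  refine ⟨y * (((M + 1 : ℕ) : ℝ) / ((M + 1 : ℕ) + 1)) ^ N, ?_⟩
  refine filter_roots_eq_map (injOn_of_strictMonoOn_mul h4) h2 (fun l hl => ⟨h5 l hl, (h3 l hl).le⟩) ?_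
  refine zeroCount_bellMap_le_card T N (ordConnected_signed_Ioc hσ _) (by simp) ?_
    fun x hx => h1 x hx.1 hx.2
  refine ⟨σ * (y * (((M + 1 : ℕ) : ℝ) / ((M + 1 : ℕ) + 1)) ^ N), ?_⟩
  have hσ2 : σ * σ = 1 := by rw [← abs_mul_abs_self, hσ, one_mul]
  rw [Set.mem_ofPred_eq, ← mul_assoc, hσ2, one_mul]
  exact ⟨by positivity, le_rfl⟩

/-- All zeros of sign `σ`, if there are finitely many changes of sign. -/
theorem eventually_filter_roots {P : ℝ[X]} (hP : ∀ m : ℕ, 0 < m → P.eval (m : ℝ) ≠ 0) {σ : ℝ}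
    (hσ : |σ| = 1) {r : ℕ → ℕ → ℝ}
    (hroot : ∀ l, 0 < l → ∀ᶠ N in atTop, r l N ∈ (bellMap (X ^ N * P)).roots)
    (hr : ∀ l, 0 < l →
      Tendsto (fun N => r l N / (balancePoint P l * ((l : ℝ) / (l + 1)) ^ N)) atTop (𝓝 1))
    {T : Finset ℕ}
    (hT : ∀ l, l ∈ T ↔ 0 < l ∧ σ * (P.eval (l : ℝ) * P.eval ((l : ℝ) + 1)) < 0) :
    ∀ᶠ N in atTop, (bellMap (X ^ N * P)).roots.filter (fun x => 0 < σ * x) =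
      T.val.map (fun l => r l N) := by
  have hT' := fun l => (hT l).1
  have hroot' := (Filter.eventually_all_finset T).2 fun l hl => hroot l (hT' l hl).1
  filter_upwards [hroot', eventually_strictMonoOn hr hT', eventually_signed_pos hr hT',
    eventually_gt_atTop 0] with N h2 h4 h5 hN
  refine filter_roots_eq_map (injOn_of_strictMonoOn_mul h4) h2 h5 ?_
  refine zeroCount_bellMap_le_card T N (ordConnected_signed_Ioi hσ) (by simp) ?_ fun x hx => ?_
  · have hσ2 : σ * σ = 1 := by rw [← abs_mul_abs_self, hσ, one_mul]
    exact ⟨σ, by rw [Set.mem_ofPred_eq, hσ2]; exact one_pos⟩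
  · refine no_zero_of_forall_pos hσ one_pos (fun k hk => ?_) hN hx
    rw [mul_comm]
    exact signs_midpointPoly_mul hP hσ one_pos hk fun i hi _ => by
      rw [hT]
      exact ⟨fun h => h.2, fun h => ⟨by omega, h⟩⟩

/-! ### Sorted lists of zeros and enumeration of index sets -/

theorem sort_add_eq_append {α : Type*} {R : α → α → Prop} [DecidableRel R] [IsTrans α R]
    [Std.Antisymm R] [Std.Total R] {A B : Multiset α} (h : ∀ a ∈ A, ∀ b ∈ B, R a b) :
    (A + B).sort R = A.sort R ++ B.sort R := by
  refine List.Perm.eq_of_pairwise' (r := R) (Multiset.pairwise_sort _ _) ?_ ?_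
  · exact List.pairwise_append.2 ⟨Multiset.pairwise_sort _ _, Multiset.pairwise_sort _ _,
      fun a ha b hb => h a ((Multiset.mem_sort _).1 ha) b ((Multiset.mem_sort _).1 hb)⟩
  · rw [← Multiset.coe_eq_coe, ← Multiset.coe_add]
    simp only [Multiset.sort_eq]

theorem sort_filter_range_eq_map_nth (p : ℕ → Prop) [DecidablePred p] (n : ℕ) :
    ((Finset.range n).filter p).val.sort (· ≤ ·) = (List.range (Nat.count p n)).map (Nat.nth p) := by
  have hcard : ∀ j < Nat.count p n, ∀ hf : (Set.ofPred p).Finite, j < hf.toFinset.card :=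
    fun j hj hf => hj.trans_le (Nat.count_le_card hf n)
  have hpair : ((List.range (Nat.count p n)).map (Nat.nth p)).Pairwise (· < ·) := by
    rw [List.pairwise_map]
    refine List.pairwise_lt_range.imp_of_mem fun {i j} _ hj hij => ?_
    exact Nat.nth_lt_nth' hij (hcard j (List.mem_range.1 hj))
  refine List.Perm.eq_of_pairwise' (r := (· ≤ ·)) (Multiset.pairwise_sort _ _)
    (hpair.imp le_of_lt) ?_
  refine (List.perm_ext_iff_of_nodup ?_ (hpair.imp ne_of_lt)).2 fun l => ?_
  · rw [← Multiset.coe_nodup, Multiset.sort_eq]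
    exact Finset.nodup _
  · rw [Multiset.mem_sort, Finset.mem_val, Finset.mem_filter, Finset.mem_range, List.mem_map]
    constructor
    · rintro ⟨hl, hpl⟩
      exact ⟨Nat.count p l, List.mem_range.2 (Nat.count_strict_mono hpl hl), Nat.nth_count hpl⟩
    · rintro ⟨i, hi, rfl⟩
      have hi' := List.mem_range.1 hi
      exact ⟨Nat.nth_lt_of_lt_count hi', Nat.nth_mem i (hcard i hi')⟩

/-- Sorting a multiset whose first elements are the `f l`, for `l < n` with `p l`. -/
theorem sort_eq_map_nth_append {p : ℕ → Prop} [DecidablePred p] {n : ℕ} {f : ℕ → ℝ}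
    {R : ℝ → ℝ → Prop} [DecidableRel R] [IsTrans ℝ R] [Std.Antisymm R] [Std.Total R]
    {A B : Multiset ℝ}
    (hA : A = ((Finset.range n).filter p).val.map f + B)
    (hf : ∀ a ∈ (Finset.range n).filter p, ∀ b ∈ (Finset.range n).filter p, a ≤ b ↔ R (f a) (f b))
    (hB : ∀ a ∈ (Finset.range n).filter p, ∀ b ∈ B, R (f a) b) :
    A.sort R = (List.range (Nat.count p n)).map (fun i => f (Nat.nth p i)) ++ B.sort R := by
  rw [hA, sort_add_eq_append, ← Multiset.map_sort f _ (· ≤ ·) R hf, sort_filter_range_eq_map_nth,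
    List.map_map]
  · rfl
  · intro a ha b hb
    obtain ⟨l, hl, rfl⟩ := Multiset.mem_map.1 ha
    exact hB l hl b hb

theorem getD_map_range_append (g : ℕ → ℝ) {s m : ℕ} (hm : m < s) (L : List ℝ) :
    ((List.range s).map g ++ L).getD m 0 = g m := by
  rw [List.getD_append _ _ _ _ (by simpa using hm)]
  simp [hm]

/-- The extra `-1` in the exponent contributes `(l+1)/l`, which turns the factor `l` into the `l +
1` of `balancePoint`. -/
theorem zeroApprox_eq {K : ℕ} {P : ℝ[X]} {l n : ℕ} (hl : 0 < l) (hn : K ≤ n) :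
    zeroApprox K P l n = balancePoint P l * ((l : ℝ) / (l + 1)) ^ (n - K) := by
  have hq : (l : ℝ) / (l + 1) ≠ 0 := by positivity
  have h : ((n : ℤ) - (K : ℤ)) = ((n - K : ℕ) : ℤ) := by push_cast [hn]; rfl
  have hl' : (l : ℝ) ≠ 0 := by positivity
  rw [zeroApprox, balancePoint, h, zpow_sub_one₀ hq, zpow_natCast]
  field_simp

/-! ### The two index sets -/

/-- Each sign change gives a root of `P` in `(l, l + 1)`, and its floor recovers `l`. -/
theorem signChangeSet_finite {P : ℝ[X]} (hP : P ≠ 0) : (signChangeSet P).Finite := by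
  refine ((P.roots.toFinset.image (fun x => ⌊x⌋₊)).finite_toSet).subset fun l hl => ?_
  have hl2 : P.eval (l : ℝ) * P.eval ((l : ℝ) + 1) < 0 := hl.2
  have hle : (l : ℝ) ≤ l + 1 := by linarith
  obtain ⟨x, hx, hx0⟩ : ∃ x ∈ Set.Ioo (l : ℝ) (l + 1), P.eval x = 0 := by
    rcases mul_neg_iff.1 hl2 with h | h
    · exact intermediate_value_Ioo' hle P.continuousOn ⟨h.2, h.1⟩
    · exact intermediate_value_Ioo hle P.continuousOn ⟨h.1, h.2⟩
  refine Finset.mem_coe.2 (Finset.mem_image.2 ⟨x, Multiset.mem_toFinset.2 ((mem_roots hP).2 hx0), ?_⟩)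
  exact (Nat.floor_eq_iff ((Nat.cast_nonneg l).trans hx.1.le)).2 ⟨hx.1.le, hx.2⟩

theorem signKeepSet_infinite {P : ℝ[X]} (hP : P ≠ 0) : (signKeepSet P).Infinite := by
  intro h
  refine Set.Ioi_infinite 0 ((h.union (signChangeSet_finite hP)).subset fun l hl => ?_)
  by_cases hl' : l ∈ signChangeSet P
  · exact Or.inr hl'
  · exact Or.inl ⟨hl, hl'⟩

/-- As `P` does not vanish at positive integers, the complement is again given by a strict
inequality: the case `σ = -1` of the general argument. -/
theorem mem_signKeepSet_iff {P : ℝ[X]} (hP : ∀ m : ℕ, 0 < m → P.eval (m : ℝ) ≠ 0) (l : ℕ) :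
    l ∈ signKeepSet P ↔ 0 < l ∧ -1 * (P.eval (l : ℝ) * P.eval ((l : ℝ) + 1)) < 0 := by
  simp only [signKeepSet, signChangeSet, Set.mem_ofPred_eq, not_and, not_lt]
  refine and_congr_right fun hl => ?_
  have h0 : P.eval (l : ℝ) * P.eval ((l : ℝ) + 1) ≠ 0 :=
    mul_ne_zero (hP l hl) (by simpa using hP (l + 1) l.succ_pos)
  constructor
  · intro h
    have := lt_of_le_of_ne (h hl) h0.symm
    linarith
  · intro h _
    linarith


/-! ### Positive and negative zeros in order -/

theorem eventually_posZeros {P : ℝ[X]} (hP : ∀ m : ℕ, 0 < m → P.eval (m : ℝ) ≠ 0)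
    (hP0 : P ≠ 0) {r : ℕ → ℕ → ℝ}
    (hroot : ∀ l, 0 < l → ∀ᶠ N in atTop, r l N ∈ (bellMap (X ^ N * P)).roots)
    (hr : ∀ l, 0 < l →
      Tendsto (fun N => r l N / (balancePoint P l * ((l : ℝ) / (l + 1)) ^ N)) atTop (𝓝 1)) :
    ∀ᶠ N in atTop,
      {x : ℝ | 0 < x ∧ x ∈ (bellMap (X ^ N * P)).roots}.encard = (signChangeSet P).encard ∧
      (∀ x ∈ (bellMap (X ^ N * P)).roots, 0 < x → (bellMap (X ^ N * P)).rootMultiplicity x = 1) ∧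
      ∀ m < (signChangeSet P).ncard,
        (posZeros (bellMap (X ^ N * P))).getD m 0 = r (Nat.nth (· ∈ signChangeSet P) m) N := by
  classical
  obtain ⟨M, hM⟩ := (signChangeSet_finite hP0).bddAbove
  set T : Finset ℕ := (Finset.range (M + 1)).filter (· ∈ signChangeSet P) with hTdef
  have hmem : ∀ l, l ∈ T ↔ l ∈ signChangeSet P := by
    intro l
    rw [hTdef, Finset.mem_filter, Finset.mem_range]
    exact ⟨fun h => h.2, fun h => ⟨Nat.lt_succ_of_le (hM h), h⟩⟩
  have hcoe : (T : Set ℕ) = signChangeSet P := Set.ext fun l => hmem l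
  have hT : ∀ l, l ∈ T ↔ 0 < l ∧ 1 * (P.eval (l : ℝ) * P.eval ((l : ℝ) + 1)) < 0 := by
    intro l
    rw [hmem, one_mul]
    rfl
  filter_upwards [eventually_filter_roots hP (abs_one) hroot hr hT,
    eventually_strictMonoOn hr (fun l => (hT l).1)] with N h1 h2
  have hinj := injOn_of_strictMonoOn_mul h2
  simp only [one_mul] at h1 h2
  refine ⟨?_, fun x hx hx0 => rootMultiplicity_eq_one hinj h1 hx hx0, fun m hm => ?_⟩
  · rw [← hcoe, ← hinj.encard_image]
    congr 1
    ext x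
    have h3 : x ∈ (bellMap (X ^ N * P)).roots.filter (fun x => 0 < x) ↔
        x ∈ T.val.map (fun l => r l N) := by rw [h1]
    rw [Multiset.mem_filter, Multiset.mem_map] at h3
    exact and_comm.trans h3
  · have hs : m < Nat.count (· ∈ signChangeSet P) (M + 1) := by
      rwa [Nat.count_eq_card_filter_range, ← Set.ncard_coe_finset, ← hTdef, hcoe]
    have h3 := sort_eq_map_nth_append (p := (· ∈ signChangeSet P)) (n := M + 1)
      (f := fun l => r l N) (R := (· ≤ ·)) (B := 0) (h1.trans (add_zero _).symm)
      (fun a ha b hb => (h2.le_iff_le ha hb).symm) (by simp)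
    rw [posZeros, h3, getD_map_range_append _ hs]

theorem eventually_negZeros {P : ℝ[X]} (hP : ∀ m : ℕ, 0 < m → P.eval (m : ℝ) ≠ 0)
    (hP0 : P ≠ 0) {r : ℕ → ℕ → ℝ}
    (hroot : ∀ l, 0 < l → ∀ᶠ N in atTop, r l N ∈ (bellMap (X ^ N * P)).roots)
    (hr : ∀ l, 0 < l →
      Tendsto (fun N => r l N / (balancePoint P l * ((l : ℝ) / (l + 1)) ^ N)) atTop (𝓝 1))
    (s : ℕ) :
    ∀ᶠ N in atTop, s < (negZeros (bellMap (X ^ N * P))).length ∧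
      ∀ m ≤ s,
        (negZeros (bellMap (X ^ N * P))).getD m 0 = r (Nat.nth (· ∈ signKeepSet P) m) N ∧
        (bellMap (X ^ N * P)).rootMultiplicity (r (Nat.nth (· ∈ signKeepSet P) m) N) = 1 := by
  classical
  have hinf : (Set.ofPred (· ∈ signKeepSet P)).Infinite := signKeepSet_infinite hP0
  -- Cutting at the element of index `s`, counted from `0`, leaves exactly `s + 1` indices in `T`.
  set M := Nat.nth (· ∈ signKeepSet P) s with hMdef
  have hcount : Nat.count (· ∈ signKeepSet P) (M + 1) = s + 1 :=
    Nat.count_nth_succ_of_infinite hinf s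
  set T : Finset ℕ := (Finset.range (M + 1)).filter (· ∈ signKeepSet P) with hTdef
  have hT : ∀ l, l ∈ T ↔ l ≤ M ∧ 0 < l ∧ -1 * (P.eval (l : ℝ) * P.eval ((l : ℝ) + 1)) < 0 := by
    intro l
    rw [hTdef, Finset.mem_filter, Finset.mem_range, Nat.lt_succ_iff, mem_signKeepSet_iff hP]
  have hT' : ∀ l ∈ T, 0 < l ∧ -1 * (P.eval (l : ℝ) * P.eval ((l : ℝ) + 1)) < 0 :=
    fun l hl => ((hT l).1 hl).2
  have hσ : |(-1 : ℝ)| = 1 := by simp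
  filter_upwards [eventually_filter_roots_near hP hσ hroot hr hT,
    eventually_strictMonoOn hr hT'] with N ⟨ρ, h1⟩ h2
  have hinj := injOn_of_strictMonoOn_mul h2
  set p := bellMap (X ^ N * P)
  -- The negative zeros below `-ρ` are not identified; they only need to come after the known ones
  -- in decreasing order.
  have hsplit : p.roots.filter (fun x => x < 0) = T.val.map (fun l => r l N) +
      (p.roots.filter (fun x => x < 0)).filter (fun x => ¬ -1 * x ≤ ρ) := by
    have h3 : (p.roots.filter (fun x => x < 0)).filter (fun x => -1 * x ≤ ρ) =
        T.val.map (fun l => r l N) := by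
      rw [← h1, Multiset.filter_filter]
      refine Multiset.filter_congr fun x _ => ?_
      rw [and_comm]
      exact and_congr_left fun _ => by constructor <;> intro h <;> linarith
    rw [← h3, Multiset.filter_add_not]
  have hmemT : ∀ l ∈ T, r l N ∈ p.roots ∧ 0 < -1 * r l N ∧ -1 * r l N ≤ ρ := by
    intro l hl
    have h3 : r l N ∈ T.val.map (fun l => r l N) := Multiset.mem_map_of_mem _ hl
    rw [← h1, Multiset.mem_filter] at h3
    exact h3
  have hsort := sort_eq_map_nth_append (p := (· ∈ signKeepSet P)) (n := M + 1)
    (f := fun l => r l N) (R := (· ≥ ·)) hsplit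
    (fun a ha b hb => by
      have h4 := h2.le_iff_le (a := a) (b := b) ha hb
      rw [← h4, ge_iff_le]
      constructor <;> intro h <;> linarith)
    (fun a ha b hb => by
      have h4 := (Multiset.mem_filter.1 hb).2
      have h5 := (hmemT a ha).2.2
      rw [ge_iff_le]
      linarith)
  rw [hcount] at hsort
  refine ⟨?_, fun m hm => ⟨?_, ?_⟩⟩
  · rw [negZeros, hsort, List.length_append, List.length_map, List.length_range]
    omega
  · rw [negZeros, hsort, getD_map_range_append _ (Nat.lt_succ_of_le hm)]
  · have hm' : Nat.nth (· ∈ signKeepSet P) m ∈ T := by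
      rw [hTdef, Finset.mem_filter, Finset.mem_range, Nat.lt_succ_iff]
      exact ⟨Nat.nth_monotone hinf hm, Nat.nth_mem_of_infinite hinf m⟩
    exact rootMultiplicity_eq_one hinj h1 (hmemT _ hm').1 (hmemT _ hm').2

theorem tendsto_div_zeroApprox {K : ℕ} {P : ℝ[X]} {l : ℕ} (hl : 0 < l) {r : ℕ → ℝ}
    (hr : Tendsto (fun N => r N / (balancePoint P l * ((l : ℝ) / (l + 1)) ^ N)) atTop (𝓝 1))
    {f : ℕ → ℝ} (hf : ∀ᶠ n in atTop, f n = r (n - K)) :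
    Tendsto (fun n => f n / zeroApprox K P l n) atTop (𝓝 1) := by
  refine (hr.comp (tendsto_sub_atTop_nat K)).congr' ?_
  filter_upwards [hf, eventually_ge_atTop K] with n hn hK
  rw [hn, zeroApprox_eq hl hK, Function.comp_apply]

end BellZeros

/-! ### The main theorem -/

/-- Lists and the enumerations `Nat.nth` of sets of natural numbers are indexed from `0`, so that
the index `m` below stands for the `(m+1)`-st zero, respectively the `(m+1)`-st element. -/
theorem mainTheorem5 (K : ℕ) (γ : ℕ → ℝ) (hγ : γ 0 = 1)
    (hP : ∀ m : ℕ, 0 < m → (BellZeros.charPoly K γ).eval (m : ℝ) ≠ 0) :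
    (BellZeros.signChangeSet (BellZeros.charPoly K γ)).Finite ∧
    (BellZeros.signKeepSet (BellZeros.charPoly K γ)).Infinite ∧
    -- for large `n` there are exactly `s_H` positive zeros, and they are simple
    (∃ n₀ : ℕ, ∀ n ≥ n₀,
      {x : ℝ | 0 < x ∧ (BellZeros.bellComb K γ n).eval x = 0}.encard =
        (BellZeros.signChangeSet (BellZeros.charPoly K γ)).encard ∧
      ∀ x : ℝ, 0 < x → (BellZeros.bellComb K γ n).eval x = 0 →
        (BellZeros.bellComb K γ n).rootMultiplicity x = 1) ∧
    -- asymptotics of the positive zeros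
    (∀ m : ℕ, m < (BellZeros.signChangeSet (BellZeros.charPoly K γ)).ncard →
      Tendsto (fun n : ℕ =>
        (BellZeros.posZeros (BellZeros.bellComb K γ n)).getD m 0 /
          BellZeros.zeroApprox K (BellZeros.charPoly K γ)
            (Nat.nth (· ∈ BellZeros.signChangeSet (BellZeros.charPoly K γ)) m) n)
        atTop (𝓝 1)) ∧
    -- asymptotics of the rightmost negative zeros
    (∀ m : ℕ,
      Tendsto (fun n : ℕ =>
        (BellZeros.negZeros (BellZeros.bellComb K γ n)).getD m 0 /
          BellZeros.zeroApprox K (BellZeros.charPoly K γ)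
            (Nat.nth (· ∈ BellZeros.signKeepSet (BellZeros.charPoly K γ)) m) n)
        atTop (𝓝 1)) ∧
    -- for large `n` the `m` rightmost negative zeros exist and are simple
    (∀ m : ℕ, ∃ n₀ : ℕ, ∀ n ≥ n₀,
      m ≤ (BellZeros.negZeros (BellZeros.bellComb K γ n)).length ∧
      ∀ i < m, (BellZeros.bellComb K γ n).rootMultiplicity
        ((BellZeros.negZeros (BellZeros.bellComb K γ n)).getD i 0) = 1) := by
  have hP0 : BellZeros.charPoly K γ ≠ 0 := fun h => hP 1 one_pos (by simp [h])
  obtain ⟨r, hr'⟩ := BellZeros.exists_zero_sequences hP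
  have hroot := fun l hl => (hr' l hl).1
  have hr := fun l hl => (hr' l hl).2
  -- Transfers eventual statements from the exponent `N` to the degree `n = N + K`.
  have hshift : ∀ {q : ℕ → ℝ[X] → Prop},
      (∀ᶠ N in atTop, q N (BellZeros.bellMap (X ^ N * BellZeros.charPoly K γ))) →
      ∀ᶠ n in atTop, q (n - K) (BellZeros.bellComb K γ n) := by
    intro q hq
    filter_upwards [(tendsto_sub_atTop_nat K).eventually hq, eventually_ge_atTop K] with n hn hK
    rwa [← BellZeros.bellComb_eq_bellMap, Nat.sub_add_cancel hK] at hn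
  have hne := hshift (q := fun _ p => p ≠ 0) (by
    filter_upwards [hroot 1 one_pos] with N hN h
    simp [h] at hN)
  have hpos := hshift (q := fun N p =>
    {x : ℝ | 0 < x ∧ x ∈ p.roots}.encard =
      (BellZeros.signChangeSet (BellZeros.charPoly K γ)).encard ∧
    (∀ x ∈ p.roots, 0 < x → p.rootMultiplicity x = 1) ∧
    ∀ m < (BellZeros.signChangeSet (BellZeros.charPoly K γ)).ncard,
      (BellZeros.posZeros p).getD m 0 =
        r (Nat.nth (· ∈ BellZeros.signChangeSet (BellZeros.charPoly K γ)) m) N)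
    (BellZeros.eventually_posZeros hP hP0 hroot hr)
  have hneg := fun s => hshift (q := fun N p =>
    s < (BellZeros.negZeros p).length ∧ ∀ m ≤ s,
      (BellZeros.negZeros p).getD m 0 =
        r (Nat.nth (· ∈ BellZeros.signKeepSet (BellZeros.charPoly K γ)) m) N ∧
      p.rootMultiplicity
        (r (Nat.nth (· ∈ BellZeros.signKeepSet (BellZeros.charPoly K γ)) m) N) = 1)
    (BellZeros.eventually_negZeros hP hP0 hroot hr s)
  have hfin := BellZeros.signChangeSet_finite hP0
  have hinf := BellZeros.signKeepSet_infinite hP0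
  refine ⟨hfin, hinf, ?_, fun m hm => ?_, fun m => ?_, fun m => ?_⟩
  · refine eventually_atTop.1 ?_
    filter_upwards [hne, hpos] with n h0 h1
    simp only [mem_roots h0, IsRoot.def] at h1
    exact ⟨h1.1, fun x hx hx0 => h1.2.1 x hx0 hx⟩
  · have hmem : Nat.nth (· ∈ BellZeros.signChangeSet (BellZeros.charPoly K γ)) m ∈
        BellZeros.signChangeSet (BellZeros.charPoly K γ) :=
      Nat.nth_mem_of_lt_card hfin (by rwa [← Set.ncard_eq_toFinset_card _ hfin])
    refine BellZeros.tendsto_div_zeroApprox hmem.1 (hr _ hmem.1) ?_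
    filter_upwards [hpos] with n hn
    exact hn.2.2 m hm
  · have hmem : Nat.nth (· ∈ BellZeros.signKeepSet (BellZeros.charPoly K γ)) m ∈
        BellZeros.signKeepSet (BellZeros.charPoly K γ) := Nat.nth_mem_of_infinite hinf m
    refine BellZeros.tendsto_div_zeroApprox hmem.1 (hr _ hmem.1) ?_
    filter_upwards [hneg m] with n hn
    exact (hn.2 m le_rfl).1
  · refine eventually_atTop.1 ?_
    filter_upwards [hneg m] with n hn
    refine ⟨hn.1.le, fun i hi => ?_⟩
    rw [(hn.2 i hi.le).1]
    exact (hn.2 i hi.le).2
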